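/- Let $P$ be a set of propositional variables with a fixed effective coding by natural numbers (for instance $P=\mathbb{N}$, or $P$ finite), and let $\mathcal{L}(\Rightarrow)$ be the language \[\varphi::= p\mid \neg\varphi\mid (\varphi\wedge\varphi)\mid \Box\varphi\mid(\varphi\Rightarrow\varphi),\qquad p\in P,\] with $\varphi\to\psi:=\neg(\varphi\wedge\neg\psi)$ and $\Diamond\varphi:=\neg\Box\neg\varphi$; let $\mathcal{L}$ be the set of formulas that do not contain $\Rightarrow$. A model $\mathcal{M}=\langle W,V\rangle$ consists of a nonempty set $W$ and a set $V(p)\subseteq W$ for each $p\in P$. Truth of a formula at a world $w\in W$ relative to an information state $X\subseteq W$ (possibly empty, and possibly with $w\notin X$) is defined, with the Kolodny--MacFarlane clause for the indicative conditional $\Rightarrow$, by: \begin{itemize} \item $\mathcal{M},w,X\vDash p$ iff $w\in V(p)$; $\mathcal{M},w,X\vDash\neg\varphi$ iff $\mathcal{M},w,X\nvDash\varphi$; $\mathcal{M},w,X\vDash\varphi\wedge\psi$ iff $\mathcal{M},w,X\vDash\varphi$ and $\mathcal{M},w,X\vDash\psi$; \item $\mathcal{M},w,X\vDash\Box\varphi$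 iff $\mathcal{M},v,X\vDash\varphi$ for all $v\in X$; \item $\mathcal{M},w,X\vDash\varphi\Rightarrow\psi$ iff $\mathcal{M},w,X'\vDash\Box\psi$ for all $X'$ such that (i) $X'\subseteq X$, (ii) $X'\subseteq\{v\in X'\mid \mathcal{M},v,X'\vDash\varphi\}$, and (iii) there is no $X''$ satisfying (i) and (ii) such that $X'\subsetneq X''$. \end{itemize} A formula is valid if it is true at every world relative to every information state in every model. Let $\mathsf{K45}$ be the smallest set of $\mathcal{L}$-formulas that contains all substitution instances in $\mathcal{L}$ of propositional tautologies and all instances in $\mathcal{L}$ of $\Box(\varphi\to\psi)\to(\Box\varphi\to\Box\psi)$, $\Diamond\Diamond\varphi\to\Diamond\varphi$ and $\Diamond\Box\varphi\to\Box\varphi$, and that is closed under modus ponens and necessitation for $\Box$. Then: \begin{enumerate} \item there is a computable translation $t$ from $\mathcal{L}(\Rightarrow)$ to $\mathcal{L}$ such that for every $\varphi\in\mathcal{L}(\Rightarrow)$, $\mathcal{M},w,X\vDash\varphi$ iff $\mathcal{M},w,X\vDash t(\varphi)$ for all $\mathcal{M},w,X$, and $t$ is full and faithful as a translation into $\mathsf{K45}$: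 $\varphi$ is valid iff $t(\varphi)\in\mathsf{K45}$; \item $\mathsf{K45}$ is decidable; \item validity of $\mathcal{L}(\Rightarrow)$-formulas is decidable. \end{enumerate} -/

import Mathlib

universe u v

/-- Formulas of the language `L(⇒)` over a set `P` of propositional variables:
`φ ::= p | ¬φ | (φ ∧ φ) | □φ | (φ ⇒ φ)`. -/
inductive Formula (P : Type u) : Type u where
  | atom : P → Formula P
  | neg : Formula P → Formula P
  | and : Formula P → Formula P → Formula P
  | box : Formula P → Formula P
  | cond : Formula P → Formula P → Formula P

namespace Formula

variable {P : Type u}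

/-- Material implication `φ → ψ`, that is `¬(φ ∧ ¬ψ)`. -/
def imp (φ ψ : Formula P) : Formula P := neg (and φ (neg ψ))

/-- `◇φ := ¬□¬φ`. -/
def dia (φ : Formula P) : Formula P := neg (box (neg φ))

/-- Membership in the basic modal language `L`: the formula does not contain `⇒`. -/
def IsBasic : Formula P → Prop
  | atom _ => True
  | neg φ => IsBasic φ
  | and φ ψ => IsBasic φ ∧ IsBasic ψ
  | box φ => IsBasic φ
  | cond _ _ => False

/-! ### Coding of formulas by natural numbers

Computability of functions and predicates on formulas refers to the following Gödel numbering. -/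

/-- The Gödel number of a formula. -/
def code [Encodable P] : Formula P → ℕ
  | atom p => 5 * Encodable.encode p
  | neg φ => 5 * code φ + 1
  | box φ => 5 * code φ + 2
  | and φ ψ => 5 * Nat.pair (code φ) (code ψ) + 3
  | cond φ ψ => 5 * Nat.pair (code φ) (code ψ) + 4

/-- Parsing of Gödel numbers. -/
def ofCode [Encodable P] (n : ℕ) : Option (Formula P) :=
  if h0 : n % 5 = 0 then (Encodable.decode (n / 5)).map atom
  else
    have h : n / 5 < n := by omega
    have hl : (n / 5).unpair.1 < n := lt_of_le_of_lt (Nat.unpair_left_le _) h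
    have hr : (n / 5).unpair.2 < n := lt_of_le_of_lt (Nat.unpair_right_le _) h
    if n % 5 = 1 then (ofCode (n / 5)).map neg
    else if n % 5 = 2 then (ofCode (n / 5)).map box
    else if n % 5 = 3 then
      (ofCode (n / 5).unpair.1).bind fun φ => (ofCode (n / 5).unpair.2).map fun ψ => and φ ψ
    else
      (ofCode (n / 5).unpair.1).bind fun φ => (ofCode (n / 5).unpair.2).map fun ψ => cond φ ψ
termination_by n

theorem ofCode_code [Encodable P] (φ : Formula P) : ofCode (code φ) = some φ := by
  induction φ with
  | atom p => rw [ofCode]; simp [code]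
  | neg φ ih =>
    rw [ofCode, code]
    have h1 : (5 * code φ + 1) % 5 = 1 := by omega
    have h2 : (5 * code φ + 1) / 5 = code φ := by omega
    simp [h1, h2, ih]
  | box φ ih =>
    rw [ofCode, code]
    have h1 : (5 * code φ + 2) % 5 = 2 := by omega
    have h2 : (5 * code φ + 2) / 5 = code φ := by omega
    simp [h1, h2, ih]
  | and φ ψ ih1 ih2 =>
    rw [ofCode, code]
    have h1 : (5 * Nat.pair (code φ) (code ψ) + 3) % 5 = 3 := by omega
    have h2 : (5 * Nat.pair (code φ) (code ψ) + 3) / 5 = Nat.pair (code φ) (code ψ) := by omega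
    simp [h1, h2, ih1, ih2]
  | cond φ ψ ih1 ih2 =>
    rw [ofCode, code]
    have h1 : (5 * Nat.pair (code φ) (code ψ) + 4) % 5 = 4 := by omega
    have h2 : (5 * Nat.pair (code φ) (code ψ) + 4) / 5 = Nat.pair (code φ) (code ψ) := by omega
    simp [h1, h2, ih1, ih2]

instance encodable [Encodable P] : Encodable (Formula P) where
  encode := code
  decode := ofCode
  encodek := ofCode_code

/-- One step of the course-of-values recursion that computes `encode ∘ decode` on formulas. -/
def codeStep [Encodable P] (l : List ℕ) : ℕ :=
  if l.length % 5 = 0 then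
    (if Encodable.encode (Encodable.decode (α := P) (l.length / 5)) = 0 then 0
      else 5 * (Encodable.encode (Encodable.decode (α := P) (l.length / 5)) - 1) + 1)
  else if l.length % 5 ≤ 2 then
    (if l.getD (l.length / 5) 0 = 0 then 0
      else 5 * (l.getD (l.length / 5) 0 - 1) + l.length % 5 + 1)
  else
    (if l.getD (l.length / 5).unpair.1 0 = 0 then 0
      else if l.getD (l.length / 5).unpair.2 0 = 0 then 0
      else 5 * Nat.pair (l.getD (l.length / 5).unpair.1 0 - 1)
          (l.getD (l.length / 5).unpair.2 0 - 1) + l.length % 5 + 1)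

theorem primrec_codeStep [Primcodable P] : Primrec (codeStep (P := P)) := by
  have hlen : Primrec (fun l : List ℕ => l.length) := Primrec.list_length
  have hr : Primrec (fun l : List ℕ => l.length % 5) :=
    Primrec.nat_mod.comp hlen (Primrec.const 5)
  have hm : Primrec (fun l : List ℕ => l.length / 5) :=
    Primrec.nat_div.comp hlen (Primrec.const 5)
  have hu := Primrec.unpair.comp hm
  have hp : Primrec (fun l : List ℕ =>
      Encodable.encode (Encodable.decode (α := P) (l.length / 5))) :=
    Primrec.encdec.comp hm
  have hget : ∀ {f : List ℕ → ℕ}, Primrec f → Primrec (fun l : List ℕ => l.getD (f l) 0) :=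
    fun hf => (Primrec.list_getD 0).comp Primrec.id hf
  have ha := hget hm
  have hb := hget (Primrec.fst.comp hu)
  have hc := hget (Primrec.snd.comp hu)
  have hpred : ∀ {f : List ℕ → ℕ}, Primrec f → Primrec (fun l => f l - 1) :=
    fun hf => Primrec.nat_sub.comp hf (Primrec.const 1)
  have hmul : ∀ {f : List ℕ → ℕ}, Primrec f → Primrec (fun l => 5 * f l) :=
    fun hf => Primrec.nat_mul.comp (Primrec.const 5) hf
  have hadd : ∀ {f g : List ℕ → ℕ}, Primrec f → Primrec g → Primrec (fun l => f l + g l) :=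
    fun hf hg => Primrec.nat_add.comp hf hg
  have h1 := Primrec.const (α := List ℕ) 1
  have h0 := Primrec.const (α := List ℕ) 0
  have hz : ∀ {f : List ℕ → ℕ}, Primrec f → PrimrecPred (fun l => f l = 0) :=
    fun hf => Primrec.eq.comp hf h0
  have hpair : ∀ {f g : List ℕ → ℕ}, Primrec f → Primrec g →
      Primrec (fun l => Nat.pair (f l) (g l)) :=
    fun hf hg => Primrec₂.natPair.comp hf hg
  unfold codeStep
  refine Primrec.ite (hz hr) ?_ (Primrec.ite ?_ ?_ ?_)
  · exact Primrec.ite (hz hp) h0 (hadd (hmul (hpred hp)) h1)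
  · exact Primrec.nat_le.comp hr (Primrec.const 2)
  · exact Primrec.ite (hz ha) h0 (hadd (hadd (hmul (hpred ha)) hr) h1)
  · exact Primrec.ite (hz hb) h0 (Primrec.ite (hz hc) h0
      (hadd (hadd (hmul (hpair (hpred hb) (hpred hc))) hr) h1))

theorem codeStep_eq [Encodable P] (n : ℕ) :
    codeStep (P := P) ((List.range n).map fun k => Encodable.encode (ofCode (P := P) k)) =
      Encodable.encode (ofCode (P := P) n) := by
  have key : ∀ k, k < n →
      ((List.range n).map fun k => Encodable.encode (ofCode (P := P) k)).getD k 0 =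
        Encodable.encode (ofCode (P := P) k) := by
    intro k hk
    simp [List.getD, hk]
  have encS : ∀ φ : Formula P, Encodable.encode (some φ) = code φ + 1 := fun _ => rfl
  unfold codeStep
  simp only [List.length_map, List.length_range]
  by_cases h0 : n % 5 = 0
  · rw [if_pos h0, ofCode, dif_pos h0]
    cases h : Encodable.decode (α := P) (n / 5) with
    | none => simp
    | some p => simp [encS, code]
  have h : n / 5 < n := by omega
  have hl : (n / 5).unpair.1 < n := lt_of_le_of_lt (Nat.unpair_left_le _) h
  have hr : (n / 5).unpair.2 < n := lt_of_le_of_lt (Nat.unpair_right_le _) h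
  rw [key _ h, key _ hl, key _ hr, if_neg h0, ofCode.eq_1 n, dif_neg h0]
  have hlt : n % 5 < 5 := Nat.mod_lt _ (by norm_num)
  have hcases : n % 5 = 1 ∨ n % 5 = 2 ∨ n % 5 = 3 ∨ n % 5 = 4 := by omega
  rcases hcases with h5 | h5 | h5 | h5
  · cases h1 : ofCode (P := P) (n / 5) <;> simp [h5, encS, code]
  · cases h1 : ofCode (P := P) (n / 5) <;> simp [h5, encS, code]
  · cases h1 : ofCode (P := P) (n / 5).unpair.1 <;>
      cases h2 : ofCode (P := P) (n / 5).unpair.2 <;> simp [h5, encS, code]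
  · cases h1 : ofCode (P := P) (n / 5).unpair.1 <;>
      cases h2 : ofCode (P := P) (n / 5).unpair.2 <;> simp [h5, encS, code]

instance primcodable [Primcodable P] : Primcodable (Formula P) where
  toEncodable := encodable
  prim := by
    have h : Primrec₂ fun (_ : Unit) (n : ℕ) => Encodable.encode (ofCode (P := P) n) := by
      refine Primrec.nat_strong_rec _
        (g := fun _ l => some (codeStep (P := P) l)) ?_ ?_
      · exact Primrec.option_some.comp (primrec_codeStep.comp Primrec.snd)
      · intro _ n
        rw [codeStep_eq]
    exact Primrec.nat_iff.1 (h.comp (Primrec.const ()) Primrec.id)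

end Formula

/-- A model `⟨W, V⟩`: a nonempty set `W` of worlds and a proposition `V p ⊆ W` for each
propositional variable `p`. -/
structure Model (P : Type u) where
  World : Type v
  nonempty : Nonempty World
  V : P → Set World

/-- `Sat M φ w X` is `M, w, X ⊨ φ`, truth of `φ` at the world `w` relative to the information
state `X`, with the Kolodny–MacFarlane clause for `⇒`: every maximal `X' ⊆ X` that accepts the
antecedent accepts the consequent. -/
def Sat {P : Type u} (M : Model.{u, v} P) : Formula P → M.World → Set M.World → Prop
  | .atom p, w, _ => w ∈ M.V p
  | .neg φ, w, X => ¬ Sat M φ w X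
  | .and φ ψ, w, X => Sat M φ w X ∧ Sat M ψ w X
  | .box φ, _, X => ∀ u ∈ X, Sat M φ u X
  | .cond φ ψ, _, X =>
      ∀ X' : Set M.World,
        X' ⊆ X → X' ⊆ {u ∈ X' | Sat M φ u X'} →
        (¬ ∃ X'' : Set M.World, X'' ⊆ X ∧ X'' ⊆ {u ∈ X'' | Sat M φ u X''} ∧ X' ⊂ X'') →
        ∀ u ∈ X', Sat M ψ u X'

/-- Validity: truth at every world relative to every information state in every model. -/
def Valid {P : Type u} (φ : Formula P) : Prop :=
  ∀ (M : Model.{u, v} P) (w : M.World) (X : Set M.World), Sat M φ w X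

/-- Substitution instances of propositional tautologies: formulas true under all truth-value
assignments to formulas that respect the Boolean connectives. -/
def IsTautology {P : Type u} (φ : Formula P) : Prop :=
  ∀ t : Formula P → Prop,
    (∀ α, t (.neg α) ↔ ¬ t α) → (∀ α β, t (.and α β) ↔ t α ∧ t β) → t φ

/-- The theorems of the normal modal logic `K45`, in the basic modal language `L`. -/
inductive K45 {P : Type u} : Formula P → Prop
  | taut {φ : Formula P} : φ.IsBasic → IsTautology φ → K45 φ
  | axK {φ ψ : Formula P} : φ.IsBasic → ψ.IsBasic →
      K45 ((Formula.box (φ.imp ψ)).imp (φ.box.imp ψ.box))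
  | ax4 {φ : Formula P} : φ.IsBasic → K45 (φ.dia.dia.imp φ.dia)
  | ax5 {φ : Formula P} : φ.IsBasic → K45 (φ.box.dia.imp φ.box)
  | mp {φ ψ : Formula P} : K45 (φ.imp ψ) → K45 φ → K45 ψ
  | nec {φ : Formula P} : K45 φ → K45 φ.box

/-! Truth of `φ` at `w, X` depends only on which of the finitely many atoms of `φ` hold at `w`, and
on which patterns of these atoms are realised in `X`. Indeed, any map of worlds that preserves the
relevant atoms preserves truth when `X` is replaced by its image (`sat_image_iff`).

Decidability: patterns are coded as bitmasks and sets of patterns as bitmasks of bitmasks. Truth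
then becomes a primitive recursive predicate `evalCode`, and validity and equivalence need only a
bounded check.

Translation: only finitely many pairs of a pattern and a set of patterns exist, and a basic formula
describes each, so every formula is equivalent to a disjunction of such descriptions
(`expressible_sat`). That argument picks the disjuncts classically; computability of `t` comes from
unbounded search for an equivalent basic formula (`exists_computable_translation`).

Fullness and faithfulness reduce to soundness and completeness of `K45` for basic formulas
(`k45_iff`), by a canonical model built from compactness of propositional logic. -/

/-! ### Bounded morphisms between models -/

namespace Formula

/-- The atoms of `φ` all satisfy `A`. -/
def AtomsIn {P : Type u} (A : P → Prop) : Formula P → Prop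
  | atom p => A p
  | neg φ => AtomsIn A φ
  | and φ ψ => AtomsIn A φ ∧ AtomsIn A ψ
  | box φ => AtomsIn A φ
  | cond φ ψ => AtomsIn A φ ∧ AtomsIn A ψ

theorem AtomsIn.mono {P : Type u} {A B : P → Prop} (h : ∀ p, A p → B p) {φ : Formula P}
    (hφ : φ.AtomsIn A) : φ.AtomsIn B := by
  induction φ with
  | atom p => exact h p hφ
  | neg φ ih => exact ih hφ
  | box φ ih => exact ih hφ
  | and φ ψ ih₁ ih₂ => exact ⟨ih₁ hφ.1, ih₂ hφ.2⟩
  | cond φ ψ ih₁ ih₂ => exact ⟨ih₁ hφ.1, ih₂ hφ.2⟩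

/-- Lets a bound on the code of a formula serve as a bound on the atoms that matter to it. -/
theorem atomsIn_encode_lt {P : Type u} [Encodable P] {N : ℕ} {φ : Formula P} (h : code φ < N) :
    φ.AtomsIn fun p => Encodable.encode p < N := by
  induction φ with
  | atom p => simp only [code] at h; simp only [AtomsIn]; omega
  | neg φ ih => simp only [code] at h; exact ih (by omega)
  | box φ ih => simp only [code] at h; exact ih (by omega)
  | and φ ψ ih₁ ih₂ =>
    simp only [code] at h
    have := Nat.left_le_pair (code φ) (code ψ)
    have := Nat.right_le_pair (code φ) (code ψ)
    exact ⟨ih₁ (by omega), ih₂ (by omega)⟩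
  | cond φ ψ ih₁ ih₂ =>
    simp only [code] at h
    have := Nat.left_le_pair (code φ) (code ψ)
    have := Nat.right_le_pair (code φ) (code ψ)
    exact ⟨ih₁ (by omega), ih₂ (by omega)⟩

end Formula

section Transfer

variable {P : Type u}

/-- `X` accepts `φ`: every world of `X` satisfies `φ` relative to `X`. -/
def Accepts (M : Model.{u, v} P) (φ : Formula P) (X : Set M.World) : Prop :=
  ∀ u ∈ X, Sat M φ u X

/-- Maximality is stated with `⊆` only, since images preserve inclusion but not strict inclusion. -/
theorem sat_cond_iff (M : Model.{u, v} P) (φ ψ : Formula P) (w : M.World) (X : Set M.World) :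
    Sat M (.cond φ ψ) w X ↔ ∀ Y ⊆ X, Accepts M φ Y →
      (∀ Z ⊆ X, Accepts M φ Z → Y ⊆ Z → Z ⊆ Y) → Accepts M ψ Y := by
  have key : ∀ Y : Set M.World, Y ⊆ {u ∈ Y | Sat M φ u Y} ↔ Accepts M φ Y := fun Y =>
    ⟨fun h u hu => (h hu).2, fun h u hu => ⟨hu, h u hu⟩⟩
  simp only [Sat, key, ssubset_iff_subset_not_subset]
  refine forall_congr' fun Y => imp_congr_right fun _ => imp_congr_right fun _ => ?_
  refine imp_congr ?_ Iff.rfl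
  push Not
  rfl

universe v'

/-- In the conditional case, `Y ↦ f '' Y` and `Y' ↦ X ∩ f ⁻¹' Y'` carry maximal accepting subsets of
`X` and of `f '' X` to one another; `f '' (X ∩ f ⁻¹' Y') = Y'` whenever `Y' ⊆ f '' X`. Neither
injectivity nor surjectivity of `f` is needed. -/
theorem sat_image_iff {M : Model.{u, v} P} {M' : Model.{u, v'} P} {A : P → Prop}
    (f : M.World → M'.World) (hf : ∀ p, A p → ∀ w, w ∈ M.V p ↔ f w ∈ M'.V p)
    {φ : Formula P} (hφ : φ.AtomsIn A) (w : M.World) (X : Set M.World) :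
    Sat M φ w X ↔ Sat M' φ (f w) (f '' X) := by
  have acc : ∀ ψ : Formula P, (∀ w X, Sat M ψ w X ↔ Sat M' ψ (f w) (f '' X)) →
      ∀ X, Accepts M ψ X ↔ Accepts M' ψ (f '' X) := by
    intro ψ ih X
    simp only [Accepts, Set.forall_mem_image, ih]
  induction φ generalizing w X with
  | atom p => exact hf p hφ w
  | neg φ ih => exact not_congr (ih hφ w X)
  | and φ ψ ih₁ ih₂ => exact and_congr (ih₁ hφ.1 w X) (ih₂ hφ.2 w X)
  | box φ ih => exact acc φ (ih hφ) X
  | cond φ ψ ih₁ ih₂ =>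
    have acc₁ := acc φ (ih₁ hφ.1)
    have acc₂ := acc ψ (ih₂ hφ.2)
    rw [sat_cond_iff, sat_cond_iff]
    constructor
    · intro h Y' hY' hacc hmax
      have him : f '' (X ∩ f ⁻¹' Y') = Y' := by
        rw [Set.image_inter_preimage, Set.inter_eq_right]; exact hY'
      rw [← him, ← acc₂]
      refine h _ Set.inter_subset_left ((acc₁ _).2 (him.symm ▸ hacc)) fun Z hZ hZacc hle => ?_
      refine Set.subset_inter hZ (Set.image_subset_iff.1 ?_)
      refine hmax _ (Set.image_mono hZ) ((acc₁ Z).1 hZacc) ?_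
      rw [← him]
      exact Set.image_mono hle
    · intro h Y hY hacc hmax
      rw [acc₂]
      refine h _ (Set.image_mono hY) ((acc₁ Y).1 hacc) fun Z' hZ' hZacc hle => ?_
      have him : f '' (X ∩ f ⁻¹' Z') = Z' := by
        rw [Set.image_inter_preimage, Set.inter_eq_right]; exact hZ'
      rw [← him]
      refine Set.image_mono (hmax _ Set.inter_subset_left ((acc₁ _).2 (him.symm ▸ hZacc)) ?_)
      exact Set.subset_inter hY (Set.image_subset_iff.1 hle)

end Transfer

/-! ### Evaluation over bitmasks -/

/-- Inclusion of finite sets of natural numbers coded by their bits. -/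
def BitSubset (S T : ℕ) : Prop := ∀ i < S, S.testBit i = true → T.testBit i = true

/-- One step of the evaluation of the formula with code `n` at the world `a` and the information
state with bitmask `S`, given the evaluation `L` for smaller codes. -/
def evalBody (L : ℕ → ℕ → ℕ → Prop) (n a S : ℕ) : Prop :=
  (n % 5 = 0 ∧ a.testBit (n / 5) = true) ∨
  (n % 5 = 1 ∧ ¬ L (n / 5) a S) ∨
  (n % 5 = 2 ∧ ∀ b < S, S.testBit b = true → L (n / 5) b S) ∨
  (n % 5 = 3 ∧ L (n / 5).unpair.1 a S ∧ L (n / 5).unpair.2 a S) ∨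
  (n % 5 = 4 ∧ ∀ Y < S + 1, BitSubset Y S →
    (∀ b < Y, Y.testBit b = true → L (n / 5).unpair.1 b Y) →
    (∀ Z < S + 1, BitSubset Z S → (∀ b < Z, Z.testBit b = true → L (n / 5).unpair.1 b Z) →
      BitSubset Y Z → BitSubset Z Y) →
    ∀ b < Y, Y.testBit b = true → L (n / 5).unpair.2 b Y)

/-- Evaluation never consults worlds above `max a S` or states above `S`, which is what permits a
recursion in a fixed number base. -/
theorem evalBody_congr {L L' : ℕ → ℕ → ℕ → Prop} {n a S : ℕ}
    (h : ∀ k < n, ∀ b ≤ max a S, ∀ T ≤ S, L k b T ↔ L' k b T) :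
    evalBody L n a S ↔ evalBody L' n a S := by
  unfold evalBody
  have h5 : n % 5 ≠ 0 → n / 5 < n := by omega
  have hl : n % 5 ≠ 0 → (n / 5).unpair.1 < n := fun h =>
    lt_of_le_of_lt (Nat.unpair_left_le _) (h5 h)
  have hr : n % 5 ≠ 0 → (n / 5).unpair.2 < n := fun h =>
    lt_of_le_of_lt (Nat.unpair_right_le _) (h5 h)
  have hacc : ∀ k < n, ∀ Y ≤ S, (∀ b < Y, Y.testBit b = true → L k b Y) ↔
      ∀ b < Y, Y.testBit b = true → L' k b Y := fun k hk Y hY =>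
    forall₂_congr fun b hb => imp_congr_right fun _ =>
      h k hk b (le_max_of_le_right (hb.le.trans hY)) Y hY
  refine or_congr Iff.rfl (or_congr ?_ (or_congr ?_ (or_congr ?_ ?_))) <;>
    refine and_congr_right fun hn => ?_
  · exact not_congr (h _ (h5 (by omega)) _ (le_max_left _ _) _ le_rfl)
  · exact hacc _ (h5 (by omega)) _ le_rfl
  · exact and_congr (h _ (hl (by omega)) _ (le_max_left _ _) _ le_rfl)
      (h _ (hr (by omega)) _ (le_max_left _ _) _ le_rfl)
  · refine forall₂_congr fun Y hY => imp_congr_right fun _ => imp_congr ?_ (imp_congr ?_ ?_)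
    · exact hacc _ (hl (by omega)) _ (by omega)
    · refine forall₂_congr fun Z hZ => imp_congr_right fun _ => imp_congr ?_ Iff.rfl
      exact hacc _ (hl (by omega)) _ (by omega)
    · exact hacc _ (hr (by omega)) _ (by omega)

/-- Truth of the formula with code `n` at the world `a` relative to the bitmask `S`. -/
def evalCode (n a S : ℕ) : Prop := evalBody (fun k b T => ∃ _ : k < n, evalCode k b T) n a S
termination_by n

theorem evalCode_eq (n a S : ℕ) : evalCode n a S ↔ evalBody evalCode n a S := by
  rw [evalCode]
  exact evalBody_congr fun k hk b _ T _ => by simp [hk]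

/-! ### Primitive recursiveness of the evaluation -/

theorem PrimrecPred.ball_lt {α : Type*} [Primcodable α] {p : α → ℕ → Prop} {f : α → ℕ}
    (hf : Primrec f) (hp : PrimrecPred fun q : α × ℕ => p q.1 q.2) :
    PrimrecPred fun a => ∀ x < f a, p a x :=
  ((PrimrecRel.forall_mem_list (R := fun x a => p a x)
    (PrimrecPred.comp hp (Primrec.snd.pair Primrec.fst))).comp
      (Primrec.list_range.comp hf) Primrec.id).of_eq (by simp)

theorem PrimrecPred.imp {α : Type*} [Primcodable α] {p q : α → Prop} (hp : PrimrecPred p)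
    (hq : PrimrecPred q) : PrimrecPred fun a => p a → q a :=
  (hp.not.or hq).of_eq fun _ => imp_iff_not_or.symm

theorem Primrec.two_pow : Primrec fun n : ℕ => 2 ^ n :=
  (Primrec.nat_rec₁ 1 (Primrec.nat_mul.comp Primrec.snd (Primrec.const 2)).to₂).of_eq fun n => by
    induction n with
    | zero => rfl
    | succ n ih => simp only [pow_succ, ← ih]

theorem PrimrecPred.testBit {α : Type*} [Primcodable α] {f g : α → ℕ} (hf : Primrec f)
    (hg : Primrec g) : PrimrecPred fun a => (f a).testBit (g a) = true :=
  (Primrec.eq.comp (Primrec.nat_mod.comp (Primrec.nat_div.comp hf (Primrec.two_pow.comp hg))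
    (Primrec.const 2)) (Primrec.const 1)).of_eq fun a => by
      simp [Nat.testBit_eq_decide_div_mod_eq]

theorem PrimrecPred.bitSubset {α : Type*} [Primcodable α] {f g : α → ℕ} (hf : Primrec f)
    (hg : Primrec g) : PrimrecPred fun a => BitSubset (f a) (g a) :=
  .ball_lt hf (.imp (.testBit (hf.comp .fst) .snd) (.testBit (hg.comp .fst) .snd))

theorem PrimrecPred.evalBody {α : Type*} [Primcodable α] {L : α → ℕ → ℕ → ℕ → Prop}
    (hL : PrimrecPred fun q : α × ℕ × ℕ × ℕ => L q.1 q.2.1 q.2.2.1 q.2.2.2)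
    {n a S : α → ℕ} (hn : Primrec n) (ha : Primrec a) (hS : Primrec S) :
    PrimrecPred fun x => _root_.evalBody (L x) (n x) (a x) (S x) := by
  have hr : ∀ c, PrimrecPred fun x => n x % 5 = c := fun c =>
    Primrec.eq.comp (Primrec.nat_mod.comp hn (.const 5)) (.const c)
  have h5 : Primrec fun x => n x / 5 := Primrec.nat_div.comp hn (.const 5)
  have hl : Primrec fun x => (n x / 5).unpair.1 := Primrec.fst.comp (Primrec.unpair.comp h5)
  have hr' : Primrec fun x => (n x / 5).unpair.2 := Primrec.snd.comp (Primrec.unpair.comp h5)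
  have hacc : ∀ k : α → ℕ, Primrec k → PrimrecPred fun q : α × ℕ =>
      ∀ b < q.2, q.2.testBit b = true → L q.1 (k q.1) b q.2 := fun k hk =>
    .ball_lt .snd (.imp (.testBit (Primrec.snd.comp .fst) .snd)
      (hL.comp (((Primrec.fst.comp .fst)).pair ((hk.comp (Primrec.fst.comp .fst)).pair
        (Primrec.snd.pair (Primrec.snd.comp .fst))))))
  have hS1 : Primrec fun x => S x + 1 := Primrec.succ.comp hS
  refine ((hr 0).and (.testBit ha h5)).or (((hr 1).and ?_).or (((hr 2).and ?_).or
    (((hr 3).and ?_).or ((hr 4).and ?_))))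
  · exact (hL.comp (Primrec.id.pair (h5.pair (ha.pair hS)))).not
  · exact (hacc _ h5).comp (Primrec.id.pair hS)
  · exact (hL.comp (Primrec.id.pair (hl.pair (ha.pair hS)))).and
      (hL.comp (Primrec.id.pair (hr'.pair (ha.pair hS))))
  · refine .ball_lt hS1 (.imp (.bitSubset .snd (hS.comp .fst)) (.imp (hacc _ hl) (.imp ?_
      (hacc _ hr'))))
    refine .ball_lt (hS1.comp .fst) (.imp (.bitSubset .snd (hS.comp (Primrec.fst.comp .fst)))
      (.imp ?_ (.imp (.bitSubset (Primrec.snd.comp .fst) .snd)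
        (.bitSubset .snd (Primrec.snd.comp .fst)))))
    exact (hacc _ hl).comp ((Primrec.fst.comp .fst).pair .snd)

theorem mixedRadix_digits (k : ℕ) {b T B : ℕ} (hb : b < B) (hT : T < B) :
    ((k * B + b) * B + T) / B = k * B + b ∧ ((k * B + b) * B + T) % B = T ∧
      (k * B + b) / B = k ∧ (k * B + b) % B = b := by
  have hB : 0 < B := by omega
  refine ⟨?_, ?_, ?_, ?_⟩
  · rw [mul_comm, Nat.mul_add_div hB, Nat.div_eq_of_lt hT, add_zero]
  · rw [Nat.mul_add_mod', Nat.mod_eq_of_lt hT]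
  · rw [mul_comm, Nat.mul_add_div hB, Nat.div_eq_of_lt hb, add_zero]
  · rw [Nat.mul_add_mod', Nat.mod_eq_of_lt hb]

/-- The triple `(n, a, S)` is packed as `m = (n * B + a) * B + S` with `a, S < B`. A recursive call
lowers the leading digit `n` and keeps the others below `B`, so it lowers `m`, and course-of-values
recursion on `m` applies. -/
theorem primrecPred_evalCode : PrimrecPred fun q : ℕ × ℕ × ℕ => evalCode q.1 q.2.1 q.2.2 := by
  classical
  have h : Primrec₂ fun B m : ℕ => decide (evalCode (m / B / B) (m / B % B) (m % B)) := by
    refine Primrec.nat_strong_rec _ (g := fun B l => some (decide (evalBody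
      (fun k b T => l.getD ((k * B + b) * B + T) false = true)
      (l.length / B / B) (l.length / B % B) (l.length % B)))) ?_ ?_
    · have hB : Primrec fun x : ℕ × List Bool => x.1 := .fst
      have hlen : Primrec fun x : ℕ × List Bool => x.2.length := Primrec.list_length.comp .snd
      have hd := Primrec.nat_div.comp hlen hB
      refine Primrec.option_some.comp (PrimrecPred.decide (PrimrecPred.evalBody ?_
        (Primrec.nat_div.comp hd hB) (Primrec.nat_mod.comp hd hB) (Primrec.nat_mod.comp hlen hB)))
      have hB' : Primrec fun q : (ℕ × List Bool) × ℕ × ℕ × ℕ => q.1.1 := hB.comp .fst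
      refine Primrec.eq.comp ((Primrec.list_getD false).comp (Primrec.snd.comp .fst)
        (Primrec.nat_add.comp (Primrec.nat_mul.comp (Primrec.nat_add.comp (Primrec.nat_mul.comp
          (Primrec.fst.comp .snd) hB') (Primrec.fst.comp (Primrec.snd.comp .snd))) hB')
          (Primrec.snd.comp (Primrec.snd.comp .snd)))) (.const true)
    · intro B m
      simp only [List.length_map, List.length_range, Option.some.injEq, decide_eq_decide]
      rw [evalCode_eq]
      refine evalBody_congr fun k hk b hb T hT => ?_
      -- In base `0` the leading digit `m / 0 / 0` is `0`, so there are no recursive calls.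
      rcases Nat.eq_zero_or_pos B with rfl | hB
      · simp at hk
      have hb : b < B := hb.trans_lt (max_lt (Nat.mod_lt _ hB) (Nat.mod_lt _ hB))
      have hT : T < B := hT.trans_lt (Nat.mod_lt _ hB)
      obtain ⟨e1, e2, e3, e4⟩ := mixedRadix_digits k hb hT
      -- The entry looked up is already in the list, so the default `false` is never read.
      have hlt : (k * B + b) * B + T < m := by
        by_contra hle
        have := Nat.div_le_div_right (c := B) (Nat.div_le_div_right (c := B) (not_lt.1 hle))
        rw [e1, e3] at this
        omega
      simp [List.getD, hlt, e1, e2, e3, e4]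
  have hB : Primrec fun q : ℕ × ℕ × ℕ => q.2.1 + q.2.2 + 1 :=
    Primrec.succ.comp (Primrec.nat_add.comp (Primrec.fst.comp .snd) (Primrec.snd.comp .snd))
  refine Primrec.primrecPred ((h.comp hB (Primrec.nat_add.comp (Primrec.nat_mul.comp
    (Primrec.nat_add.comp (Primrec.nat_mul.comp .fst hB) (Primrec.fst.comp .snd)) hB)
    (Primrec.snd.comp .snd))).of_eq ?_)
  rintro ⟨k, b, T⟩
  simp only
  set B := b + T + 1
  have hb : b < B := by omega
  have hT : T < B := by omega
  obtain ⟨e1, e2, e3, e4⟩ := mixedRadix_digits k hb hT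
  rw [e1, e2, e3, e4]

/-! ### Reduction to the model of bitmasks -/

section BitModel

variable {P : Type u} [Encodable P]

/-- The model whose worlds are bitmasks of sets of atoms. -/
def bitModel (P : Type u) [Encodable P] : Model.{u, v} P where
  World := ULift.{v} ℕ
  nonempty := ⟨⟨0⟩⟩
  V p := {a | a.down.testBit (Encodable.encode p) = true}

/-- The world with bitmask `a`. -/
def bitWorld (P : Type u) [Encodable P] (a : ℕ) : (bitModel.{u, v} P).World := ULift.up.{v} a

/-- The information state with bitmask `S`. -/
def bitState (P : Type u) [Encodable P] (S : ℕ) : Set (bitModel.{u, v} P).World :=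
  {a : ULift.{v} ℕ | S.testBit a.down = true}

theorem bitModel_forall {p : (bitModel.{u, v} P).World → Prop} :
    (∀ x, p x) ↔ ∀ a, p (bitWorld P a) :=
  ⟨fun h _ => h _, fun h x => h (ULift.down.{v} x)⟩

theorem bitWorld_mem_V {a : ℕ} {p : P} : bitWorld.{u, v} P a ∈ (bitModel P).V p ↔
    a.testBit (Encodable.encode p) = true := Iff.rfl

theorem bitWorld_mem_bitState {a S : ℕ} : bitWorld.{u, v} P a ∈ bitState P S ↔
    S.testBit a = true := Iff.rfl

/-- Hence the bounds `b < S` in `evalBody` and `BitSubset` lose no members. -/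
theorem lt_of_testBit {S b : ℕ} (h : S.testBit b = true) : b < S :=
  Nat.lt_two_pow_self.trans_le (Nat.ge_two_pow_of_testBit h)

theorem bitState_subset_iff {S T : ℕ} :
    bitState.{u, v} P S ⊆ bitState P T ↔ BitSubset S T :=
  ⟨fun h i _ hi => h (a := bitWorld P i) hi,
    fun h => bitModel_forall.2 fun a ha => h a (lt_of_testBit ha) ha⟩

/-- Hence the bounds `Y < S + 1` and `Z < S + 1` in `evalBody` lose no substates. -/
theorem le_of_bitState_subset {S T : ℕ} (h : bitState.{u, v} P S ⊆ bitState P T) : S ≤ T :=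
  Nat.le_of_testBit fun i hi => h (a := bitWorld P i) hi

theorem exists_testBit_iff (N : ℕ) (Q : ℕ → Prop) :
    ∃ S < 2 ^ N, ∀ i, S.testBit i = true ↔ i < N ∧ Q i := by
  classical
  refine ⟨Nat.ofBits fun i : Fin N => decide (Q i), Nat.ofBits_lt_two_pow _, fun i => ?_⟩
  rw [Nat.testBit_ofBits]
  split_ifs with h <;> simp [h]

theorem exists_eq_bitState {X : Set (bitModel.{u, v} P).World} {N : ℕ}
    (h : ∀ a, bitWorld P a ∈ X → a < N) : ∃ S < 2 ^ N, X = bitState P S := by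
  obtain ⟨S, hS, hbit⟩ := exists_testBit_iff N fun i => bitWorld P i ∈ X
  refine ⟨S, hS, Set.ext (bitModel_forall.2 fun a => ?_)⟩
  rw [bitWorld_mem_bitState, hbit]
  exact ⟨fun ha => ⟨h a ha, ha⟩, fun ha => ha.2⟩

theorem exists_eq_bitState_of_subset {X : Set (bitModel.{u, v} P).World} {S : ℕ}
    (h : X ⊆ bitState P S) : ∃ T ≤ S, X = bitState P T := by
  obtain ⟨T, -, rfl⟩ := exists_eq_bitState (X := X) (N := S) fun a ha => lt_of_testBit (h ha)
  exact ⟨T, le_of_bitState_subset h, rfl⟩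

/-- Every subset of a bitmask state is again a bitmask state with a smaller or equal mask, so
quantification over information states becomes bounded quantification over numbers. -/
theorem sat_bitModel_iff (φ : Formula P) (a S : ℕ) :
    Sat (bitModel.{u, v} P) φ (bitWorld P a) (bitState P S) ↔ evalCode φ.code a S := by
  have acc : ∀ ψ : Formula P,
      (∀ a S, Sat (bitModel.{u, v} P) ψ (bitWorld P a) (bitState P S) ↔ evalCode ψ.code a S) →
      ∀ S, Accepts (bitModel.{u, v} P) ψ (bitState P S) ↔
        ∀ b < S, S.testBit b = true → evalCode ψ.code b S := fun ψ ih S => by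
    simp only [Accepts, bitModel_forall, bitWorld_mem_bitState, ih]
    exact forall_congr' fun b => ⟨fun h _ => h, fun h hb => h (lt_of_testBit hb) hb⟩
  induction φ generalizing a S with
  | atom p =>
    rw [evalCode_eq, evalBody]
    simp only [Formula.code]
    simp [Sat, bitWorld_mem_V]
  | neg φ ih =>
    have h1 : (5 * φ.code + 1) % 5 = 1 := by omega
    have h2 : (5 * φ.code + 1) / 5 = φ.code := by omega
    rw [evalCode_eq, evalBody]
    simp [Formula.code, h1, h2, Sat, ih]
  | box φ ih =>
    have h1 : (5 * φ.code + 2) % 5 = 2 := by omega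
    have h2 : (5 * φ.code + 2) / 5 = φ.code := by omega
    rw [evalCode_eq, evalBody]
    simp only [Formula.code, h1, h2]
    simpa using! acc φ ih S
  | and φ ψ ih₁ ih₂ =>
    have h1 : (5 * Nat.pair φ.code ψ.code + 3) % 5 = 3 := by omega
    have h2 : (5 * Nat.pair φ.code ψ.code + 3) / 5 = Nat.pair φ.code ψ.code := by omega
    rw [evalCode_eq, evalBody]
    simp [Formula.code, h1, h2, Sat, ih₁, ih₂]
  | cond φ ψ ih₁ ih₂ =>
    have h1 : (5 * Nat.pair φ.code ψ.code + 4) % 5 = 4 := by omega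
    have h2 : (5 * Nat.pair φ.code ψ.code + 4) / 5 = Nat.pair φ.code ψ.code := by omega
    rw [sat_cond_iff, evalCode_eq, evalBody]
    simp only [Formula.code, h1, h2, Nat.unpair_pair]
    simp only [OfNat.ofNat_ne_zero, false_and, Nat.reduceEqDiff, true_and, false_or,
      ← acc φ ih₁, ← acc ψ ih₂, ← bitState_subset_iff.{u, v} (P := P), Nat.lt_succ_iff]
    constructor
    · intro h Y _ hYS hacc hmax
      refine h _ hYS hacc fun Z hZ hZacc hYZ => ?_
      obtain ⟨T, hT, rfl⟩ := exists_eq_bitState_of_subset hZ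
      exact hmax T hT hZ hZacc hYZ
    · intro h Y hY hacc hmax
      obtain ⟨T, hT, rfl⟩ := exists_eq_bitState_of_subset hY
      exact h T hT hY hacc fun Z _ => hmax _

/-- Each world is sent to the mask, below `2 ^ N`, of its true atoms with code below `N`; the image
of `X` then has a mask below `2 ^ 2 ^ N`. One pair `a, S` serves all `φ` at once, so two formulas
can be compared. -/
theorem exists_evalCode_iff (M : Model.{u, v} P) (w : M.World) (X : Set M.World) (N : ℕ) :
    ∃ a < 2 ^ N, ∃ S < 2 ^ 2 ^ N, ∀ φ : Formula P, φ.code < N →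
      (Sat M φ w X ↔ evalCode φ.code a S) := by
  choose τ hτ hbit using fun w : M.World =>
    exists_testBit_iff N fun i => ∃ p, Encodable.encode p = i ∧ w ∈ M.V p
  have hV : ∀ p : P, Encodable.encode p < N → ∀ w, w ∈ M.V p ↔
      bitWorld.{u, 0} P (τ w) ∈ (bitModel P).V p := by
    intro p hp w
    simp [bitWorld_mem_V, hbit, hp]
  obtain ⟨S, hS, hX⟩ := exists_eq_bitState (N := 2 ^ N)
    (X := (fun w => bitWorld.{u, 0} P (τ w)) '' X) (by
      rintro a ⟨w, -, hw⟩
      obtain rfl : τ w = a := congrArg ULift.down.{0} hw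
      exact hτ w)
  refine ⟨τ w, hτ w, S, hS, fun φ hφ => ?_⟩
  rw [sat_image_iff (M' := bitModel.{u, 0} P) _ hV (Formula.atomsIn_encode_lt hφ), hX,
    ← sat_bitModel_iff.{u, 0}]

/-- The right side does not mention the universe `v`, so validity does not depend on it. -/
theorem valid_iff_evalCode (φ : Formula P) : Valid.{u, v} φ ↔
    ∀ a < 2 ^ (φ.code + 1), ∀ S < 2 ^ 2 ^ (φ.code + 1), evalCode φ.code a S := by
  constructor
  · intro h a _ S _
    exact (sat_bitModel_iff.{u, v} φ a S).1 (h _ _ _)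
  · intro h M w X
    obtain ⟨a, ha, S, hS, hφ⟩ := exists_evalCode_iff M w X (φ.code + 1)
    exact (hφ φ (Nat.lt_succ_self _)).2 (h a ha S hS)

/-- Semantic equivalence of formulas, decided on bitmasks. -/
def EvalEquiv (φ ψ : Formula P) : Prop :=
  ∀ a < 2 ^ (φ.code + ψ.code + 1), ∀ S < 2 ^ 2 ^ (φ.code + ψ.code + 1),
    (evalCode φ.code a S ↔ evalCode ψ.code a S)

theorem EvalEquiv.sat_iff {φ ψ : Formula P} (h : EvalEquiv φ ψ) (M : Model.{u, v} P)
    (w : M.World) (X : Set M.World) : Sat M φ w X ↔ Sat M ψ w X := by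
  obtain ⟨a, ha, S, hS, hN⟩ := exists_evalCode_iff M w X (φ.code + ψ.code + 1)
  rw [hN φ (by omega), hN ψ (by omega)]
  exact h a ha S hS

theorem evalEquiv_of_sat_iff {φ ψ : Formula P}
    (h : ∀ (M : Model.{u, 0} P) (w : M.World) (X : Set M.World), Sat M φ w X ↔ Sat M ψ w X) :
    EvalEquiv φ ψ := by
  intro a _ S _
  rw [← sat_bitModel_iff.{u, 0}, ← sat_bitModel_iff.{u, 0}]
  exact h _ _ _

end BitModel

/-! ### Decision procedures and the search for a translation -/

section Computability

variable {P : Type u} [Primcodable P]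

theorem Formula.primrec_code : Primrec (Formula.code : Formula P → ℕ) := Primrec.encode

theorem primrecPred_forall_evalCode {α : Type*} [Primcodable α] {N : α → ℕ} (hN : Primrec N)
    {p : α → ℕ → ℕ → Prop} (hp : PrimrecPred fun q : (α × ℕ) × ℕ => p q.1.1 q.1.2 q.2) :
    PrimrecPred fun x => ∀ a < 2 ^ N x, ∀ S < 2 ^ 2 ^ N x, p x a S :=
  .ball_lt (Primrec.two_pow.comp hN)
    (.ball_lt (Primrec.two_pow.comp (Primrec.two_pow.comp (hN.comp .fst))) hp)

theorem primrecPred_valid : PrimrecPred fun φ : Formula P => Valid.{u, v} φ :=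
  (primrecPred_forall_evalCode (Primrec.succ.comp Formula.primrec_code)
    (primrecPred_evalCode.comp ((Formula.primrec_code.comp (Primrec.fst.comp .fst)).pair
      ((Primrec.snd.comp .fst).pair .snd)))).of_eq fun φ => (valid_iff_evalCode φ).symm

theorem primrecRel_evalEquiv : PrimrecRel (EvalEquiv (P := P)) := by
  have h1 : Primrec fun q : ((Formula P × Formula P) × ℕ) × ℕ => q.1.1.1.code :=
    Formula.primrec_code.comp (Primrec.fst.comp (Primrec.fst.comp .fst))
  have h2 : Primrec fun q : ((Formula P × Formula P) × ℕ) × ℕ => q.1.1.2.code :=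
    Formula.primrec_code.comp (Primrec.snd.comp (Primrec.fst.comp .fst))
  have h3 : Primrec fun q : ((Formula P × Formula P) × ℕ) × ℕ => (q.1.2, q.2) :=
    (Primrec.snd.comp .fst).pair .snd
  refine primrecPred_forall_evalCode (Primrec.succ.comp (Primrec.nat_add.comp
    (Formula.primrec_code.comp .fst) (Formula.primrec_code.comp .snd))) ?_
  have e1 := primrecPred_evalCode.comp (h1.pair h3)
  have e2 := primrecPred_evalCode.comp (h2.pair h3)
  exact ((e1.imp e2).and (e2.imp e1)).of_eq fun _ => iff_iff_implies_and_implies.symm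

/-- Recognition of the codes of basic formulas. -/
def basicCode (n : ℕ) : Bool :=
  if h : n % 5 = 0 then true
  else if n % 5 ≤ 2 then basicCode (n / 5)
  else if n % 5 = 3 then basicCode (n / 5).unpair.1 && basicCode (n / 5).unpair.2
  else false
termination_by n
decreasing_by
  · omega
  · exact lt_of_le_of_lt (Nat.unpair_left_le _) (by omega)
  · exact lt_of_le_of_lt (Nat.unpair_right_le _) (by omega)

theorem primrec_basicCode : Primrec basicCode := by
  have h : Primrec₂ fun (_ : Unit) (n : ℕ) => basicCode n := by
    refine Primrec.nat_strong_rec _ (g := fun _ l => some (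
      if l.length % 5 = 0 then true
      else if l.length % 5 ≤ 2 then l.getD (l.length / 5) false
      else if l.length % 5 = 3 then l.getD (l.length / 5).unpair.1 false &&
        l.getD (l.length / 5).unpair.2 false
      else false)) ?_ ?_
    · have hl : Primrec fun x : Unit × List Bool => x.2 := .snd
      have hlen := Primrec.list_length.comp hl
      have hm := Primrec.nat_mod.comp hlen (Primrec.const 5)
      have hd := Primrec.nat_div.comp hlen (Primrec.const 5)
      have hu := Primrec.unpair.comp hd
      have hg : ∀ {f : Unit × List Bool → ℕ}, Primrec f →
          Primrec fun x : Unit × List Bool => x.2.getD (f x) false :=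
        fun hf => (Primrec.list_getD false).comp hl hf
      exact Primrec.option_some.comp (Primrec.ite (Primrec.eq.comp hm (.const 0)) (.const true)
        (Primrec.ite (Primrec.nat_le.comp hm (.const 2)) (hg hd)
          (Primrec.ite (Primrec.eq.comp hm (.const 3))
            (Primrec.and.comp (hg (Primrec.fst.comp hu)) (hg (Primrec.snd.comp hu)))
            (.const false))))
    · intro _ n
      have key : ∀ k < n, ((List.range n).map basicCode).getD k false = basicCode k := by
        intro k hk
        simp [List.getD, hk]
      rw [basicCode]
      simp only [List.length_map, List.length_range, Option.some.injEq, dite_eq_ite]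
      by_cases h0 : n % 5 = 0
      · simp [h0]
      have hd : n / 5 < n := by omega
      rw [key _ hd, key _ (lt_of_le_of_lt (Nat.unpair_left_le _) hd),
        key _ (lt_of_le_of_lt (Nat.unpair_right_le _) hd)]
  exact h.comp (.const ()) .id

theorem basicCode_code_iff (φ : Formula P) : basicCode φ.code = true ↔ φ.IsBasic := by
  induction φ with
  | atom p => rw [basicCode]; simp [Formula.code, Formula.IsBasic]
  | neg φ ih =>
    have h1 : (5 * φ.code + 1) % 5 = 1 := by omega
    have h2 : (5 * φ.code + 1) / 5 = φ.code := by omega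
    rw [basicCode]; simp [Formula.code, Formula.IsBasic, h1, h2, ih]
  | box φ ih =>
    have h1 : (5 * φ.code + 2) % 5 = 2 := by omega
    have h2 : (5 * φ.code + 2) / 5 = φ.code := by omega
    rw [basicCode]; simp [Formula.code, Formula.IsBasic, h1, h2, ih]
  | and φ ψ ih₁ ih₂ =>
    have h1 : (5 * Nat.pair φ.code ψ.code + 3) % 5 = 3 := by omega
    have h2 : (5 * Nat.pair φ.code ψ.code + 3) / 5 = Nat.pair φ.code ψ.code := by omega
    rw [basicCode]; simp [Formula.code, Formula.IsBasic, h1, h2, ih₁, ih₂]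
  | cond φ ψ =>
    have h1 : (5 * Nat.pair φ.code ψ.code + 4) % 5 = 4 := by omega
    rw [basicCode]; simp [Formula.code, Formula.IsBasic, h1]

theorem primrecPred_isBasic : PrimrecPred fun φ : Formula P => φ.IsBasic :=
  (Primrec.eq.comp (primrec_basicCode.comp Formula.primrec_code) (.const true)).of_eq
    basicCode_code_iff

/-- The translation returns the first basic formula, in order of codes, that is equivalent to `φ`.
The test is decidable and `h` makes the search halt. -/
theorem exists_computable_translation
    (h : ∀ φ : Formula P, ∃ χ : Formula P, χ.IsBasic ∧ EvalEquiv φ χ) :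
    ∃ t : Formula P → Formula P, Computable t ∧ ∀ φ, (t φ).IsBasic ∧ EvalEquiv φ (t φ) := by
  classical
  let R : Formula P → Formula P → Prop := fun φ χ => χ.IsBasic ∧ EvalEquiv φ χ
  have hR : PrimrecRel R := (primrecPred_isBasic.comp .snd).and primrecRel_evalEquiv
  let Q : Formula P → ℕ → Prop := fun φ n =>
    (Encodable.decode n : Option (Formula P)).map (fun χ => decide (R φ χ)) = some true
  have hQ : PrimrecPred fun q : Formula P × ℕ => Q q.1 q.2 :=
    Primrec.eq.comp (Primrec.option_map (Primrec.decode.comp .snd)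
      (hR.decide.comp (Primrec.fst.comp .fst) .snd).to₂) (.const (some true))
  have hex : ∀ φ, ∃ n, Q φ n := fun φ => by
    obtain ⟨χ, hχ⟩ := h φ
    exact ⟨Encodable.encode χ, by simpa [Q, R] using hχ⟩
  -- The number found always decodes, so the default `φ` is never returned.
  refine ⟨fun φ => (Encodable.decode (Nat.find (hex φ))).getD φ, ?_, fun φ => ?_⟩
  · exact Computable.option_getD (Computable.decode.comp (Computable.find hQ.computablePred hex))
      Computable.id
  · have hs := Nat.find_spec (hex φ)
    obtain ⟨χ, hχ, hd⟩ := Option.map_eq_some_iff.1 hs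
    simp only [hχ, Option.getD_some]
    exact of_decide_eq_true hd

end Computability

/-! ### Completeness of `K45` -/

section Completeness

variable {P : Type u}

/-- Truth-value assignments to formulas that respect the Boolean connectives. -/
def IsValuation (t : Formula P → Bool) : Prop :=
  (∀ α, t (.neg α) = !t α) ∧ ∀ α β, t (.and α β) = (t α && t β)

theorem IsValuation.imp {t : Formula P → Bool} (ht : IsValuation t) (α β : Formula P) :
    t (α.imp β) = true ↔ (t α = true → t β = true) := by
  simp only [Formula.imp, ht.1, ht.2]
  cases t α <;> cases t β <;> simp

theorem IsValuation.foldr_imp {t : Formula P → Bool} (ht : IsValuation t) (F : List (Formula P))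
    (α : Formula P) :
    t (F.foldr Formula.imp α) = true ↔ ((∀ γ ∈ F, t γ = true) → t α = true) := by
  induction F with
  | nil => simp
  | cons γ F ih => simp [ht.imp, ih]

theorem isTautology_iff {φ : Formula P} :
    IsTautology φ ↔ ∀ t : Formula P → Bool, IsValuation t → t φ = true := by
  classical
  constructor
  · intro h t ht
    exact h (fun α => t α = true) (by simp [ht.1]) (by simp [ht.2])
  · intro h t hn ha
    simpa using h (fun α => decide (t α)) ⟨fun α => by simp [hn], fun α β => by simp [ha]⟩

/-- Compactness of propositional logic: the valuations refuting `α` form a closed subset of the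
compact space `Formula P → Bool`. If no finite part of `T` sufficed, the finite intersection
property would give one making all of `T` true. -/
theorem exists_isTautology_foldr_imp {T : Set (Formula P)} {α : Formula P}
    (h : ∀ t : Formula P → Bool, IsValuation t → (∀ γ ∈ T, t γ = true) → t α = true) :
    ∃ F : List (Formula P), (∀ γ ∈ F, γ ∈ T) ∧ IsTautology (F.foldr Formula.imp α) := by
  by_contra! hF
  have hclosed : IsClosed {t : Formula P → Bool | IsValuation t ∧ t α = false} := by
    have hn : Continuous not := continuous_of_discreteTopology
    have ha : Continuous fun x : Bool × Bool => x.1 && x.2 := continuous_of_discreteTopology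
    have h1 : IsClosed {t : Formula P → Bool | ∀ β, t (.neg β) = !t β} := by
      simp only [Set.ofPred_forall]
      exact isClosed_iInter fun β =>
        isClosed_eq (continuous_apply _) (hn.comp (continuous_apply β))
    have h2 : IsClosed {t : Formula P → Bool | ∀ β γ, t (.and β γ) = (t β && t γ)} := by
      simp only [Set.ofPred_forall]
      exact isClosed_iInter fun β => isClosed_iInter fun γ =>
        isClosed_eq (continuous_apply _) (ha.comp (f := fun t : Formula P → Bool => (t β, t γ))
          ((continuous_apply β).prodMk (continuous_apply γ)))
    exact (h1.inter h2).inter (isClosed_eq (continuous_apply α) continuous_const)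
  obtain ⟨t, ⟨ht, htα⟩, hT⟩ := hclosed.isCompact.inter_iInter_nonempty
    (fun γ : T => {t : Formula P → Bool | t γ = true})
    (fun γ => isClosed_eq (continuous_apply _) continuous_const) (fun u => by
      have := hF (u.toList.map Subtype.val) (by simp +contextual)
      rw [isTautology_iff] at this
      push Not at this
      obtain ⟨t, ht, hne⟩ := this
      rw [Ne, ht.foldr_imp] at hne
      push Not at hne
      refine ⟨t, ⟨ht, by simpa using hne.2⟩, ?_⟩
      simp only [Set.mem_iInter]
      exact fun γ hγ => hne.1 _ (List.mem_map_of_mem (Finset.mem_toList.2 hγ)))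
  rw [h t ht fun γ hγ => Set.mem_iInter.1 hT ⟨γ, hγ⟩] at htα
  cases htα

namespace K45

theorem isBasic {φ : Formula P} (h : K45 φ) : φ.IsBasic := by
  induction h with
  | taut h _ => exact h
  | axK h₁ h₂ => simp [Formula.imp, Formula.IsBasic, h₁, h₂]
  | ax4 h => simpa [Formula.imp, Formula.dia, Formula.IsBasic] using h
  | ax5 h => simpa [Formula.imp, Formula.dia, Formula.IsBasic] using h
  | mp _ _ ih _ => exact ih.2
  | nec _ ih => exact ih

theorem sound {φ : Formula P} (h : K45 φ) : Valid.{u, v} φ := by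
  intro M w X
  -- The world varies while `X` stays fixed: necessitation uses its premise at every world of `X`.
  induction h generalizing w with
  | taut _ h => exact h (fun α => Sat M α w X) (fun _ => Iff.rfl) fun _ _ => Iff.rfl
  | axK => simp only [Formula.imp, Sat]; grind
  | ax4 => simp only [Formula.imp, Formula.dia, Sat]; grind
  | ax5 => simp only [Formula.imp, Formula.dia, Sat]; grind
  | mp _ _ ih₁ ih₂ =>
    have h₁ := ih₁ w
    simp only [Formula.imp, Sat, not_and, not_not] at h₁
    exact h₁ (ih₂ w)
  | nec _ ih => exact fun u _ => ih u

theorem box_imp_box {α β : Formula P} (h : K45 (α.imp β)) : K45 (α.box.imp β.box) :=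
  mp (axK h.isBasic.1 h.isBasic.2) (nec h)

theorem foldr_mp {F : List (Formula P)} {α : Formula P} (hF : ∀ γ ∈ F, K45 γ)
    (h : K45 (F.foldr Formula.imp α)) : K45 α := by
  induction F with
  | nil => exact h
  | cons γ F ih =>
    exact ih (fun δ hδ => hF δ (List.mem_cons_of_mem _ hδ)) (mp h (hF γ List.mem_cons_self))

end K45

theorem Formula.isBasic_foldr_imp {F : List (Formula P)} {α : Formula P}
    (hF : ∀ γ ∈ F, γ.IsBasic) (hα : α.IsBasic) : (F.foldr imp α).IsBasic := by
  induction F with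
  | nil => exact hα
  | cons γ F ih =>
    exact ⟨hF γ List.mem_cons_self, ih fun δ hδ => hF δ (List.mem_cons_of_mem _ hδ)⟩

/-! ### The canonical model -/

variable (P) in
/-- Boolean valuations that make all theorems of `K45` true. -/
structure K45World where
  val : Formula P → Bool
  isValuation : IsValuation val
  theorems : ∀ θ, K45 θ → val θ = true

namespace K45World

theorem box_mp (t : K45World P) {α β : Formula P} (hα : α.IsBasic) (hβ : β.IsBasic)
    (h : t.val (α.imp β).box = true) (h' : t.val α.box = true) : t.val β.box = true := by
  have := t.theorems _ (K45.axK hα hβ)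
  simp only [t.isValuation.imp] at this
  exact this h h'

theorem box_mono (t : K45World P) {α β : Formula P} (h : K45 (α.imp β))
    (h' : t.val α.box = true) : t.val β.box = true :=
  (t.isValuation.imp _ _).1 (t.theorems _ h.box_imp_box) h'

theorem box_foldr (t : K45World P) {F : List (Formula P)} {α : Formula P}
    (hF : ∀ γ ∈ F, γ.IsBasic ∧ t.val γ.box = true) (hα : α.IsBasic)
    (h : t.val (F.foldr Formula.imp α).box = true) : t.val α.box = true := by
  induction F with
  | nil => exact h
  | cons γ F ih =>
    have hF' : ∀ δ ∈ F, δ.IsBasic ∧ t.val δ.box = true := fun δ hδ =>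
      hF δ (List.mem_cons_of_mem _ hδ)
    exact ih hF' (t.box_mp (hF γ List.mem_cons_self).1
      (Formula.isBasic_foldr_imp (fun δ hδ => (hF' δ hδ).1) hα) h (hF γ List.mem_cons_self).2)

/-- Axiom 4 for `¬α`, contraposed, gives `□¬¬□¬¬α`; the double negations are then removed under the
boxes. -/
theorem box_box (t : K45World P) {α : Formula P} (hα : α.IsBasic) (h : t.val α.box = true) :
    t.val α.box.box = true := by
  have hdn : K45 (α.imp α.neg.neg) := K45.taut ⟨hα, hα⟩ fun t hn ha => by
    simp [Formula.imp, hn, ha]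
  have hdn' : K45 (α.neg.neg.imp α) := K45.taut ⟨hα, hα⟩ fun t hn ha => by
    simp [Formula.imp, hn, ha]
  have h4 := t.theorems _ (K45.ax4 (φ := α.neg) hα)
  simp only [t.isValuation.imp, Formula.dia, t.isValuation.1, t.box_mono hdn h, Bool.not_true,
    Bool.not_eq_true', Bool.false_eq_true, imp_false, Bool.not_eq_false] at h4
  refine t.box_mono (K45.mp (K45.taut ?_ fun t hn ha => ?_) hdn'.box_imp_box) h4
  · exact ⟨⟨hα, hα⟩, hα, hα⟩
  · simp [Formula.imp, hn, ha]

theorem box_neg_box (t : K45World P) {α : Formula P} (hα : α.IsBasic)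
    (h : t.val α.box ≠ true) : t.val α.box.neg.box = true := by
  have h5 := t.theorems _ (K45.ax5 hα)
  simp only [t.isValuation.imp, Formula.dia, t.isValuation.1] at h5
  simpa using mt h5 h

/-- The canonical model. -/
def model (t : K45World P) : Model.{u, u} P where
  World := K45World P
  nonempty := ⟨t⟩
  V p := {s | s.val (.atom p) = true}

/-- The canonical information state of `t`. -/
def state (t : K45World P) : Set (K45World P) :=
  {s | ∀ β : Formula P, β.IsBasic → t.val β.box = true → s.val β = true}

/-- Axioms 4 and 5 make all worlds of `t.state` agree with `t` on boxed basic formulas, so a single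
information state can interpret every nested `□`. -/
theorem box_iff_of_mem_state {t s : K45World P} (hs : s ∈ t.state) {α : Formula P}
    (hα : α.IsBasic) : s.val α.box = true ↔ t.val α.box = true := by
  refine ⟨fun h => ?_, fun h => hs _ hα (t.box_box hα h)⟩
  by_contra hne
  have := hs α.box.neg hα (t.box_neg_box hα hne)
  simp [s.isValuation.1, h] at this

/-- If `α` holds throughout `t.state`, compactness derives it from finitely many `β` with `□β` true
at `t`, and axiom K moves the derivation under `□`. Theorems need no separate treatment, since
necessitation puts them among the `β`. -/
theorem forall_state_iff (t : K45World P) {α : Formula P} (hα : α.IsBasic) :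
    (∀ s ∈ t.state, s.val α = true) ↔ t.val α.box = true := by
  refine ⟨fun h => ?_, fun h s hs => hs α hα h⟩
  obtain ⟨F, hF, htaut⟩ := exists_isTautology_foldr_imp
    (T := {β : Formula P | β.IsBasic ∧ t.val β.box = true}) (α := α) fun s hs hT =>
      h ⟨s, hs, fun θ hθ => hT θ ⟨hθ.isBasic, t.theorems _ hθ.nec⟩⟩ fun β hβ hβt => hT β ⟨hβ, hβt⟩
  exact t.box_foldr hF hα
    (t.theorems _ (K45.taut (Formula.isBasic_foldr_imp (fun γ hγ => (hF γ hγ).1) hα) htaut).nec)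

/-- The truth lemma. The case `s = t` is listed separately because `t` need not lie in `t.state`. -/
theorem sat_model_iff (t : K45World P) {α : Formula P} (hα : α.IsBasic) {s : K45World P}
    (hs : s = t ∨ s ∈ t.state) : Sat t.model α s t.state ↔ s.val α = true := by
  induction α generalizing s with
  | atom p => exact Iff.rfl
  | neg α ih => simp [Sat, s.isValuation.1, ih hα hs]
  | and α β ih₁ ih₂ => simp [Sat, s.isValuation.2, ih₁ hα.1 hs, ih₂ hα.2 hs]
  | box α ih =>
    have hst : s.val α.box = true ↔ t.val α.box = true := by
      rcases hs with rfl | hs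
      · exact Iff.rfl
      · exact box_iff_of_mem_state hs (α := α) hα
    refine Iff.trans ?_ ((t.forall_state_iff (α := α) hα).trans hst.symm)
    exact forall₂_congr fun r hr => ih hα (Or.inr hr)
  | cond α β => exact hα.elim

end K45World

/-- Every canonical world makes `φ` true, so by compactness `φ` follows tautologically from finitely
many theorems. -/
theorem K45.complete {φ : Formula P} (hφ : φ.IsBasic) (h : Valid.{u, u} φ) : K45 φ := by
  obtain ⟨F, hF, htaut⟩ := exists_isTautology_foldr_imp (T := {θ : Formula P | K45 θ}) (α := φ)
    fun s hs hT =>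
      let t : K45World P := ⟨s, hs, hT⟩
      (t.sat_model_iff hφ (Or.inl rfl)).1 (h t.model t t.state)
  exact K45.foldr_mp hF
    (K45.taut (Formula.isBasic_foldr_imp (fun γ hγ => (hF γ hγ).isBasic) hφ) htaut)

theorem k45_iff [Encodable P] {φ : Formula P} : K45 φ ↔ φ.IsBasic ∧ Valid.{u, v} φ := by
  refine ⟨fun h => ⟨h.isBasic, h.sound⟩, fun ⟨hφ, h⟩ => K45.complete hφ ?_⟩
  rw [valid_iff_evalCode] at h ⊢
  exact h

end Completeness

/-! ### Expressive power of the basic modal language -/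

section Expressivity

variable {P : Type u}

/-- Properties of pointed models defined by a basic formula. -/
def Expressible (Q : ∀ M : Model.{u, v} P, M.World → Set M.World → Prop) : Prop :=
  ∃ χ : Formula P, χ.IsBasic ∧ ∀ M w X, Sat M χ w X ↔ Q M w X

namespace Expressible

variable {Q R : ∀ M : Model.{u, v} P, M.World → Set M.World → Prop}

theorem congr (hQ : Expressible Q) (h : ∀ M w X, Q M w X ↔ R M w X) : Expressible R := by
  obtain ⟨χ, hχ, hs⟩ := hQ
  exact ⟨χ, hχ, fun M w X => (hs M w X).trans (h M w X)⟩

theorem atom (p : P) : Expressible.{u, v} fun M w _ => w ∈ M.V p :=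
  ⟨.atom p, trivial, fun _ _ _ => Iff.rfl⟩

theorem not (hQ : Expressible Q) : Expressible fun M w X => ¬ Q M w X := by
  obtain ⟨χ, hχ, hs⟩ := hQ
  exact ⟨χ.neg, hχ, fun M w X => not_congr (hs M w X)⟩

theorem and (hQ : Expressible Q) (hR : Expressible R) :
    Expressible fun M w X => Q M w X ∧ R M w X := by
  obtain ⟨χ, hχ, hs⟩ := hQ
  obtain ⟨ψ, hψ, hs'⟩ := hR
  exact ⟨χ.and ψ, ⟨hχ, hψ⟩, fun M w X => and_congr (hs M w X) (hs' M w X)⟩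

theorem box (hQ : Expressible Q) : Expressible fun M _ X => ∀ u ∈ X, Q M u X := by
  obtain ⟨χ, hχ, hs⟩ := hQ
  exact ⟨χ.box, hχ, fun M _ X => forall₂_congr fun u _ => hs M u X⟩

theorem dia (hQ : Expressible Q) : Expressible fun M _ X => ∃ u ∈ X, Q M u X :=
  hQ.not.box.not.congr fun M w X => by push Not; rfl

theorem iff (hQ : Expressible Q) (hR : Expressible R) :
    Expressible fun M w X => Q M w X ↔ R M w X :=
  ((hQ.and hR.not).not.and (hR.and hQ.not).not).congr fun M w X => by tauto

/-- The language has no constants, so an atom is needed; any formula supplies one. -/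
theorem const [Nonempty P] (c : Prop) : Expressible.{u, v} (P := P) fun _ _ _ => c := by
  obtain ⟨p⟩ := ‹Nonempty P›
  have h := (atom.{u, v} p).and (atom.{u, v} p).not
  by_cases hc : c
  · exact h.not.congr fun M w X => by simp [hc]
  · exact h.congr fun M w X => by simp [hc]

theorem forall_mem [Nonempty P] {ι : Type*} (s : Finset ι)
    {Q : ι → ∀ M : Model.{u, v} P, M.World → Set M.World → Prop} (hQ : ∀ i, Expressible (Q i)) :
    Expressible fun M w X => ∀ i ∈ s, Q i M w X := by
  classical
  induction s using Finset.induction_on with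
  | empty => exact (const True).congr fun M w X => by simp
  | insert i s _ ih => exact ((hQ i).and ih).congr fun M w X => by simp

theorem exists_mem [Nonempty P] {ι : Type*} (s : Finset ι)
    {Q : ι → ∀ M : Model.{u, v} P, M.World → Set M.World → Prop} (hQ : ∀ i, Expressible (Q i)) :
    Expressible fun M w X => ∃ i ∈ s, Q i M w X :=
  (forall_mem s fun i => (hQ i).not).not.congr fun M w X => by push Not; rfl

end Expressible

theorem Formula.nonempty_atoms (φ : Formula P) : Nonempty P := by
  induction φ with
  | atom p => exact ⟨p⟩
  | _ => assumption

theorem Formula.exists_finset_atomsIn (φ : Formula P) : ∃ A : Finset P, φ.AtomsIn (· ∈ A) := by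
  classical
  induction φ with
  | atom p => exact ⟨{p}, Finset.mem_singleton_self p⟩
  | neg φ ih => exact ih
  | box φ ih => exact ih
  | and φ ψ ih₁ ih₂ =>
    obtain ⟨A, hA⟩ := ih₁
    obtain ⟨B, hB⟩ := ih₂
    exact ⟨A ∪ B, hA.mono fun p => Finset.mem_union_left B,
      hB.mono fun p => Finset.mem_union_right A⟩
  | cond φ ψ ih₁ ih₂ =>
    obtain ⟨A, hA⟩ := ih₁
    obtain ⟨B, hB⟩ := ih₂
    exact ⟨A ∪ B, hA.mono fun p => Finset.mem_union_left B,
      hB.mono fun p => Finset.mem_union_right A⟩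

/-- The model whose worlds are finite sets of atoms. -/
def finsetModel (P : Type u) : Model.{u, u} P where
  World := Finset P
  nonempty := ⟨∅⟩
  V p := {σ | p ∈ σ}

theorem expressible_sat (φ : Formula P) : Expressible.{u, v} fun M w X => Sat M φ w X := by
  classical
  obtain ⟨A, hA⟩ := φ.exists_finset_atomsIn
  have := φ.nonempty_atoms
  have htype : ∀ σ : Finset P, Expressible.{u, v} fun M w _ =>
      ∀ p ∈ A, (w ∈ M.V p ↔ p ∈ σ) := fun σ =>
    Expressible.forall_mem A fun p => (Expressible.atom p).iff (Expressible.const _)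
  have hstate : ∀ S : Finset (Finset P), Expressible.{u, v} fun M w X => ∀ σ ∈ A.powerset,
      ((∃ x ∈ X, ∀ p ∈ A, (x ∈ M.V p ↔ p ∈ σ)) ↔ σ ∈ S) := fun S =>
    Expressible.forall_mem _ fun σ => (htype σ).dia.iff (Expressible.const _)
  -- The disjunction runs over the pairs `σ, S` at which `φ` is true in `finsetModel P`; each
  -- disjunct says that `w` has pattern `σ` and that `X` realises exactly the patterns in `S`.
  refine (Expressible.exists_mem A.powerset fun σ =>
    Expressible.exists_mem A.powerset.powerset fun S =>
      (Expressible.const (Sat (finsetModel P) φ σ (S : Set (Finset P)))).and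
        ((htype σ).and (hstate S))).congr fun M w X => ?_
  let f : M.World → Finset P := fun w => A.filter fun p => w ∈ M.V p
  have hf : ∀ σ ∈ A.powerset, ∀ x, (∀ p ∈ A, (x ∈ M.V p ↔ p ∈ σ)) ↔ f x = σ := by
    intro σ hσ x
    rw [Finset.mem_powerset] at hσ
    rw [Finset.ext_iff]
    simp only [f, Finset.mem_filter]
    refine forall_congr' fun p => ⟨fun h => ?_, fun h hp => ?_⟩
    · exact ⟨fun hp => (h hp.1).1 hp.2, fun hp => ⟨hσ hp, (h (hσ hp)).2 hp⟩⟩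
    · exact ⟨fun hx => h.1 ⟨hp, hx⟩, fun hx => (h.2 hx).2⟩
  have hfA : ∀ x, f x ∈ A.powerset := fun x => Finset.mem_powerset.2 (Finset.filter_subset _ _)
  rw [sat_image_iff (M' := finsetModel P) f (A := (· ∈ A))
    (fun p hp w => by
      refine Iff.trans ?_ (Finset.mem_filter (s := A) (p := fun p => w ∈ M.V p)).symm
      exact (and_iff_right hp).symm) hA]
  constructor
  · rintro ⟨σ, hσ, S, hS, hsat, hw, hX⟩
    obtain rfl := (hf σ hσ w).1 hw
    refine (congrArg (Sat (finsetModel P) φ (f w)) (?_ : f '' X = (S : Set (Finset P)))).mpr hsat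
    ext σ
    constructor
    · rintro ⟨x, hx, rfl⟩
      exact (hX _ (hfA x)).1 ⟨x, hx, (hf _ (hfA x) x).2 rfl⟩
    · intro hσS
      have hσ' := Finset.mem_powerset.1 hS hσS
      obtain ⟨x, hx, hxσ⟩ := (hX σ hσ').2 hσS
      exact ⟨x, hx, (hf σ hσ' x).1 hxσ⟩
  · intro h
    refine ⟨f w, hfA w, A.powerset.filter fun σ => σ ∈ f '' X,
      Finset.mem_powerset.2 (Finset.filter_subset _ _), ?_, (hf _ (hfA w) w).2 rfl, fun σ hσ => ?_⟩
    · refine (congrArg (Sat (finsetModel P) φ (f w)) (?_ : _ = f '' X)).mpr h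
      ext σ
      refine Finset.mem_filter.trans (and_iff_right_of_imp ?_)
      rintro ⟨x, -, rfl⟩
      exact hfA x
    · simp only [hf σ hσ, Finset.mem_filter, hσ, true_and]
      rfl

theorem exists_isBasic_evalEquiv [Encodable P] (φ : Formula P) :
    ∃ χ : Formula P, χ.IsBasic ∧ EvalEquiv φ χ := by
  obtain ⟨χ, hχ, h⟩ := expressible_sat.{u, 0} φ
  exact ⟨χ, hχ, evalEquiv_of_sat_iff fun M w X => (h M w X).symm⟩

end Expressivity

theorem mainTheorem3 {P : Type u} [Primcodable P] :
    (∃ t : Formula P → Formula P,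
      Computable t ∧
      (∀ φ, (t φ).IsBasic) ∧
      (∀ (φ : Formula P) (M : Model.{u, v} P) (w : M.World) (X : Set M.World),
        Sat M φ w X ↔ Sat M (t φ) w X) ∧
      (∀ φ, Valid.{u, v} φ ↔ K45 (t φ))) ∧
    ComputablePred (fun φ : Formula P => K45 φ) ∧
    ComputablePred (fun φ : Formula P => Valid.{u, v} φ) := by
  refine ⟨?_, ?_, primrecPred_valid.computablePred⟩
  · obtain ⟨t, ht, h⟩ := exists_computable_translation (P := P) exists_isBasic_evalEquiv
    refine ⟨t, ht, fun φ => (h φ).1, fun φ => (h φ).2.sat_iff, fun φ => ?_⟩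
    rw [k45_iff.{u, v}, and_iff_right (h φ).1]
    exact forall₃_congr (h φ).2.sat_iff
  · exact ((primrecPred_isBasic.and primrecPred_valid.{u, v}).of_eq
      fun φ => k45_iff.symm).computablePred
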